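/- **Theorem 1.4.** Let $t$ and $k$ be positive integers with $k$ odd, and let $G$ be a finite simple $t$-connected graph of even order $n\ge 5t+7$ (that is, $G$ has more than $t$ vertices and remains connected whenever fewer than $t$ vertices are removed). Let $\rho$ denote the adjacency spectral radius, i.e. the largest eigenvalue of the adjacency matrix, and put $$G_*=K_t\vee(K_{n-2t-3}\cup K_3\cup tK_1),$$ where $\cup$ is the disjoint union of graphs, $\vee$ is the join (disjoint union together with all edges between the two graphs) and $tK_1$ is the edgeless graph on $t$ vertices. Suppose that $G$ has a fractional perfect matching, i.e. a function $f:E(G)\to[0,1]$ such that $\sum_{e\ni v}f(e)=1$ for every vertex $v$. If $$\rho(G)\ge\rho(G_*),$$ then $G$ has a perfect $k$-matching, i.e. a function $f:E(G)\to\{0,1,\dots,k\}$ such that $\sum_{e\ni v}f(e)=k$ for every vertex $v$, unless $G$ is isomorphic to $G_*$, in which case $G$ has no perfect $k$-matching. -/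

import Mathlib

noncomputable section

namespace PerfectKMatching

open scoped Classical

variable {V W : Type*}

/-- The join `G ∨ H`: the disjoint union of `G` and `H` together with all edges between them. -/
def join (G : SimpleGraph V) (H : SimpleGraph W) : SimpleGraph (V ⊕ W) :=
  (G ⊕g H) ⊔ completeBipartiteGraph V W

/-- The complete graph `K_m`. -/
abbrev K (m : ℕ) : SimpleGraph (Fin m) := ⊤

/-- The graph `K_t ∨ (K_{n-2t-3} ∪ K_3 ∪ tK_1)`, which has `n` vertices when `n ≥ 2t + 3`.
Here `tK_1` is the graph with `t` vertices and no edges. -/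
def extremalGraph (n t : ℕ) :
    SimpleGraph (Fin t ⊕ ((Fin (n - 2 * t - 3) ⊕ Fin 3) ⊕ Fin t)) :=
  join (K t) ((K (n - 2 * t - 3) ⊕g K 3) ⊕g (⊥ : SimpleGraph (Fin t)))

/-- The (adjacency) spectral radius `ρ(G)`: the largest eigenvalue of the adjacency matrix.
The set of real eigenvalues is finite, and it is nonempty when `V` is (see
`isGreatest_spectralRadius`). -/
def spectralRadius [Fintype V] (G : SimpleGraph V) : ℝ :=
  sSup {μ : ℝ | Module.End.HasEigenvalue (Matrix.toLin' (G.adjMatrix ℝ)) μ}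

/-- For a nonempty graph the supremum above is attained, so `ρ(G)` is the largest eigenvalue. -/
theorem isGreatest_spectralRadius [Fintype V] [Nonempty V] (G : SimpleGraph V) :
    IsGreatest {μ : ℝ | Module.End.HasEigenvalue (Matrix.toLin' (G.adjMatrix ℝ)) μ}
      (spectralRadius G) := by
  have hA : (G.adjMatrix ℝ).IsHermitian := by
    rw [Matrix.IsHermitian, Matrix.conjTranspose_eq_transpose_of_trivial]
    exact SimpleGraph.transpose_adjMatrix G
  have hset : {μ : ℝ | Module.End.HasEigenvalue (Matrix.toLin' (G.adjMatrix ℝ)) μ} =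
      Set.range hA.eigenvalues := by
    rw [← hA.spectrum_real_eq_range_eigenvalues, ← Matrix.spectrum_toLin']
    ext μ
    exact Module.End.hasEigenvalue_iff_mem_spectrum
  rw [spectralRadius, hset]
  have hne : (Set.range hA.eigenvalues).Nonempty := Set.range_nonempty _
  have hfin : (Set.range hA.eigenvalues).Finite := Set.finite_range _
  exact ⟨hne.csSup_mem hfin, fun x hx => le_csSup hfin.bddAbove hx⟩

/-- `G` is `t`-connected: it has more than `t` vertices, and it stays connected whenever fewer
than `t` vertices are removed. -/
def IsTConnected [Fintype V] (G : SimpleGraph V) (t : ℕ) : Prop :=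
  t < Fintype.card V ∧ ∀ S : Finset V, S.card < t → (G.induce {v | v ∉ S}).Connected

/-- The sum of `f(e)` over the edges `e` incident with the vertex `v`. -/
def incidentSum [Fintype V] {R : Type*} [AddCommMonoid R] (G : SimpleGraph V)
    (f : G.edgeSet → R) (v : V) : R :=
  ∑ e ∈ Finset.univ.filter (fun e : G.edgeSet => v ∈ (e : Sym2 V)), f e

/-- A `k`-matching: a function `f : E(G) → {0, 1, …, k}` whose sum over the edges at any vertex
is at most `k`. -/
def IsKMatching [Fintype V] (G : SimpleGraph V) (k : ℕ) (f : G.edgeSet → ℕ) : Prop :=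
  (∀ e, f e ≤ k) ∧ ∀ v, incidentSum G f v ≤ k

/-- `G` has a perfect `k`-matching: a `k`-matching whose sum over the edges at each vertex
equals `k`. -/
def HasPerfectKMatching [Fintype V] (G : SimpleGraph V) (k : ℕ) : Prop :=
  ∃ f : G.edgeSet → ℕ, IsKMatching G k f ∧ ∀ v, incidentSum G f v = k

/-- `G` has a fractional perfect matching: a function `f : E(G) → [0, 1]` whose sum over the
edges at each vertex equals `1`. -/
def HasFractionalPerfectMatching [Fintype V] (G : SimpleGraph V) : Prop :=
  ∃ f : G.edgeSet → ℝ, (∀ e, f e ∈ Set.Icc (0 : ℝ) 1) ∧ ∀ v, incidentSum G f v = 1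

end PerfectKMatching

end

/-!
A perfect matching multiplied by `k` is a perfect `k`-matching, so it suffices to treat `k = 1`. If
there is no perfect matching, Tutte's theorem and parity give a set `U` of `s` vertices such that
`G - U` has at least `s + 2` odd components. A fractional perfect matching allows at most `s` of
them to be singletons, and `t`-connectivity forces `s ≥ t`.

Let `c - 1` be the eigenvalue of `G_*` belonging to an eigenvector constant on its four parts. On
`G` consider the vector with value `1` on `U` and `s / (c - m)` on a component of size `m`. It
satisfies `A x ≤ (c - 1) x` as soon as `s - c + s ∑ m / (c - m) ≤ 0`, the sum running over the
components (`complete_of_le_spectralRadius`). By convexity of `m / (c - m)` the sum is at most its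
value for `s` singletons, one triangle and one component of size `n - 2s - 3` (`sum_ratio_le`). The
resulting expression is convex in `s`, vanishes at `s = t` by the choice of `c`, and is negative for
the largest possible `s = (n - 6) / 2` (`cut_bound`); the last point is what `n ≥ 5t + 7` is for.
Since `c - 1 ≤ ρ(G_*) ≤ ρ(G)` and `x` is positive, Perron-Frobenius (`adjacency_sum_eq_of_le`) turns
all these inequalities into equalities, and they identify `G` with `G_*`.

Conversely, in `G_*` the isolated vertices absorb the whole weight `k t` of `K_t`, and the triangle
has no perfect `k`-matching of its own because `3k` is odd.
-/

namespace PerfectKMatching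

open scoped Classical

universe u

/-! ### The quotient equation -/

/-- For a cut `U` of size `s` leaving `s` singletons, a triangle and a clique on the other
`n - 2s - 3` vertices, the graph with all edges at the cut has the eigenvalue `c - 1` when `c`
solves this equation (here `s = t`). The root is located between the clique bound `n - t - 3`
and `n - 3`, and it also exceeds a value chosen slightly above `(1 + √5) / 4 * n`, the order of
magnitude for the competing cuts of size about `n / 2`. -/
theorem exists_root_equation {t n : ℝ} (ht : 1 ≤ t) (hn : 5 * t + 7 ≤ n) :
    ∃ c : ℝ, n - t - 3 ≤ c ∧ (81 * n - 175) / 100 ≤ c ∧ c ≤ n - 3 ∧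
      t - c + t * (t / (c - 1) + 3 / (c - 3) + (n - 2 * t - 3) / (c - (n - 2 * t - 3))) = 0 := by
  set f : ℝ → ℝ := fun c =>
    t - c + t * (t / (c - 1) + 3 / (c - 3) + (n - 2 * t - 3) / (c - (n - 2 * t - 3))) with hf
  set c₀ := max (n - t - 3) ((81 * n - 175) / 100) with hc₀
  have h1 : n - t - 3 ≤ c₀ := le_max_left _ _
  have h2 : (81 * n - 175) / 100 ≤ c₀ := le_max_right _ _
  have h3 : c₀ ≤ n - 3 := max_le (by linarith) (by linarith)
  have hcont : ContinuousOn f (Set.Icc c₀ (n - 3)) := by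
    rw [hf]
    have e1 : ∀ c ∈ Set.Icc c₀ (n - 3), c - 1 ≠ 0 := fun c hc => by
      have := hc.1; exact ne_of_gt (by linarith)
    have e2 : ∀ c ∈ Set.Icc c₀ (n - 3), c - 3 ≠ 0 := fun c hc => by
      have := hc.1; exact ne_of_gt (by linarith)
    have e3 : ∀ c ∈ Set.Icc c₀ (n - 3), c - (n - 2 * t - 3) ≠ 0 := fun c hc => by
      have := hc.1; exact ne_of_gt (by linarith)
    fun_prop (disch := assumption)
  have hleft : 0 ≤ f c₀ := by
    -- In terms of `d = c - (n - t - 3)` nonnegativity of `f c` follows from a cubic inequality.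
    have key : ∀ d : ℝ, 0 ≤ d → d * (n - t - 3 + d) ^ 2 ≤ t * (t + 3) * (t + d) →
        0 ≤ f (n - t - 3 + d) := by
      intro d hd h
      have hc : (0 : ℝ) < n - t - 3 + d := by linarith
      have a1 : t / (n - t - 3 + d) ≤ t / (n - t - 3 + d - 1) :=
        div_le_div_of_nonneg_left (by linarith) (by linarith) (by linarith)
      have a2 : 3 / (n - t - 3 + d) ≤ 3 / (n - t - 3 + d - 3) :=
        div_le_div_of_nonneg_left (by linarith) (by linarith) (by linarith)
      have a3 : d * (n - t - 3 + d) / (t + d) ≤ t * (t + 3) / (n - t - 3 + d) := by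
        rw [div_le_div_iff₀ (by linarith) hc]; linarith
      have a4 : f (n - t - 3 + d) = -(d * (n - t - 3 + d) / (t + d)) +
          t * (t / (n - t - 3 + d - 1) + 3 / (n - t - 3 + d - 3)) := by
        simp only [hf]
        have : t + d ≠ 0 := by linarith
        rw [show n - t - 3 + d - (n - 2 * t - 3) = t + d by ring, mul_add, ← add_assoc]
        have : t * ((n - 2 * t - 3) / (t + d)) =
            -(d * (n - t - 3 + d) / (t + d)) - t + (n - t - 3 + d) := by
          field_simp; ring
        rw [this]; ring
      have a5 : t * (t + 3) / (n - t - 3 + d) =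
          t * (t / (n - t - 3 + d) + 3 / (n - t - 3 + d)) := by
        field_simp
      rw [a4]
      have := mul_le_mul_of_nonneg_left (add_le_add a1 a2) (by linarith : 0 ≤ t)
      linarith
    rcases le_total ((81 * n - 175) / 100) (n - t - 3) with h | h
    · have := key 0 le_rfl (by rw [zero_mul]; positivity)
      rw [add_zero] at this
      rwa [hc₀, max_eq_left h]
    · have hh := key ((81 * n - 175) / 100 - (n - t - 3)) (by linarith) ?_
      · rwa [hc₀, max_eq_right h, ← add_sub_cancel (n - t - 3) ((81 * n - 175) / 100)]
      · obtain ⟨r, hr, rfl⟩ : ∃ r, 0 ≤ r ∧ n = 5 * t + 7 + r := ⟨n - (5 * t + 7), by linarith, by ring⟩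
        obtain ⟨d, hd, hd'⟩ : ∃ d, 0 ≤ d ∧ d = t / 20 - 8 / 100 - 19 / 100 * r :=
          ⟨_, by linarith, rfl⟩
        -- In the nonnegative parameters `r` and `d` all coefficients become positive.
        obtain rfl : t = 8 / 5 + 19 / 5 * r + 20 * d := by linarith
        rw [← sub_nonneg]
        ring_nf
        positivity
  have hright : f (n - 3) ≤ 0 := by
    simp only [hf]
    have a1 : t / (n - 3 - 1) ≤ 1 / 5 := by
      rw [div_le_div_iff₀ (by linarith) (by norm_num)]; linarith
    have a2 : 3 / (n - 3 - 3) ≤ 1 / 2 := by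
      rw [div_le_div_iff₀ (by linarith) (by norm_num)]; linarith
    have a3 : t * ((n - 2 * t - 3) / (n - 3 - (n - 2 * t - 3))) = (n - 2 * t - 3) / 2 := by
      rw [show n - 3 - (n - 2 * t - 3) = 2 * t by ring]; field_simp
    rw [mul_add, a3]
    nlinarith
  obtain ⟨c, hc, hfc⟩ := intermediate_value_Icc' h3 hcont ⟨hright, hleft⟩
  exact ⟨c, h1.trans hc.1, h2.trans hc.1, hc.2, hfc⟩

/-- The cut of largest size `(n - 6) / 2`, which leaves two triangles besides the singletons. -/
theorem largest_cut_bound {n c : ℝ} (hn : 12 ≤ n) (hc : (81 * n - 175) / 100 ≤ c) :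
    (n - 6) / 2 - c + (n - 6) / 2 * ((n - 6) / 2 / (c - 1) + 3 / (c - 3) + 3 / (c - 3)) < 0 := by
  obtain ⟨w, hw, rfl⟩ : ∃ w, 0 ≤ w ∧ n = 12 + w := ⟨n - 12, by linarith, by ring⟩
  obtain ⟨e, he, rfl⟩ : ∃ e, 0 ≤ e ∧ c = (81 * (12 + w) - 175) / 100 + e :=
    ⟨c - (81 * (12 + w) - 175) / 100, by linarith, by ring⟩
  have gen : ∀ S c : ℝ, 0 < c - 1 → 0 < c - 3 →
      0 < (c - S) * (c - 1) * (c - 3) - S ^ 2 * (c - 3) - 6 * S * (c - 1) →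
      S - c + S * (S / (c - 1) + 3 / (c - 3) + 3 / (c - 3)) < 0 := by
    intro S c h1 h3 h
    have : S - c + S * (S / (c - 1) + 3 / (c - 3) + 3 / (c - 3)) =
        -(((c - S) * (c - 1) * (c - 3) - S ^ 2 * (c - 3) - 6 * S * (c - 1)) /
          ((c - 1) * (c - 3))) := by
      have h1' := h1.ne'
      have h3' := h3.ne'
      field_simp
      ring
    rw [this]
    exact neg_neg_of_pos (div_pos h (mul_pos h1 h3))
  refine gen _ _ (by linarith) (by linarith) ?_
  ring_nf
  positivity

/-- The left side of the quotient equation is convex in the size `s` of the cut, since it is a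
convex quadratic plus a nonnegative multiple of `1 / (2s - (n - 3 - c))`. Between the root `t` and
the largest cut, where it is negative, it is therefore negative. -/
theorem cut_bound {t s n c : ℝ} (ht : 1 ≤ t) (hn : 5 * t + 7 ≤ n) (hc1 : n - t - 3 ≤ c)
    (hc2 : (81 * n - 175) / 100 ≤ c) (hc3 : c ≤ n - 3)
    (hroot : t - c + t * (t / (c - 1) + 3 / (c - 3) +
      (n - 2 * t - 3) / (c - (n - 2 * t - 3))) = 0)
    (hts : t < s) (hs : s ≤ (n - 6) / 2) :
    s - c + s * (s / (c - 1) + 3 / (c - 3) + (n - 2 * s - 3) / (c - (n - 2 * s - 3))) < 0 := by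
  set H : ℝ → ℝ := fun s =>
    s - c + s * (s / (c - 1) + 3 / (c - 3) + (n - 2 * s - 3) / (c - (n - 2 * s - 3))) with hH
  set S := (n - 6) / 2 with hS
  have hHS : H S < 0 := by
    have := largest_cut_bound (by linarith : 12 ≤ n) hc2
    simp only [hH]
    rwa [show n - 2 * S - 3 = 3 by rw [hS]; ring]
  set d := n - 3 - c with hd
  have hd0 : 0 ≤ d := by linarith
  have hy : ∀ y, t ≤ y → 0 < 2 * y - d := fun y hy => by rw [hd]; linarith
  -- Partial fractions in `y` expose the convex terms.
  have hform : ∀ y, t ≤ y → H y = y - c + y ^ 2 * (1 / (c - 1)) + y * (3 / (c - 3)) +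
      (c - 2 * y) / 2 + c * d / 2 * (1 / (2 * y - d)) := by
    intro y hty
    have h0 := (hy y hty).ne'
    simp only [hH]
    rw [show c - (n - 2 * y - 3) = 2 * y - d by rw [hd]; ring]
    have : y * ((n - 2 * y - 3) / (2 * y - d)) =
        (c - 2 * y) / 2 + c * d / 2 * (1 / (2 * y - d)) := by
      rw [show n - 2 * y - 3 = c + d - 2 * y by rw [hd]; ring]
      rw [← mul_div_assoc, ← mul_div_assoc, mul_one, div_add_div _ _ two_ne_zero h0,
        div_eq_div_iff h0 (mul_ne_zero two_ne_zero h0)]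
      ring
    rw [mul_add, this]
    ring
  have hsq : (S - t) * s ^ 2 ≤ (S - s) * t ^ 2 + (s - t) * S ^ 2 := by
    have : 0 ≤ (S - t) * ((s - t) * (S - s)) :=
      mul_nonneg (by linarith) (mul_nonneg (by linarith) (by linarith))
    nlinarith
  have hinv : (S - t) * (1 / (2 * s - d)) ≤
      (S - s) * (1 / (2 * t - d)) + (s - t) * (1 / (2 * S - d)) := by
    have e1 := hy t le_rfl
    have e2 := hy s hts.le
    have e3 := hy S (by linarith)
    have gen : ∀ x y z : ℝ, 0 < x → x ≤ y → y ≤ z →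
        (z - x) * (1 / y) ≤ (z - y) * (1 / x) + (y - x) * (1 / z) := by
      intro x y z hx hxy hyz
      have hy := hx.trans_le hxy
      have hz := hy.trans_le hyz
      rw [← sub_nonneg]
      have : (z - y) * (1 / x) + (y - x) * (1 / z) - (z - x) * (1 / y) =
          (z - x) * (y - x) * (z - y) / (x * y * z) := by
        field_simp
        ring
      rw [this]
      exact div_nonneg (mul_nonneg (mul_nonneg (by linarith) (by linarith)) (by linarith))
        (by positivity)
    have := gen (2 * t - d) (2 * s - d) (2 * S - d) e1 (by linarith) (by linarith)
    linarith
  have hconv : (S - t) * H s ≤ (S - s) * H t + (s - t) * H S := by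
    rw [hform s hts.le, hform t le_rfl, hform S (by linarith)]
    have e1 : 0 ≤ 1 / (c - 1) := one_div_nonneg.2 (by linarith)
    have e2 : 0 ≤ c * d / 2 := div_nonneg (mul_nonneg (by linarith) hd0) (by norm_num)
    have f1 := mul_le_mul_of_nonneg_right hsq e1
    have f2 := mul_le_mul_of_nonneg_left hinv e2
    linear_combination f1 + f2
  have hHt : H t = 0 := hroot
  rw [hHt, mul_zero, zero_add] at hconv
  have : (s - t) * H S < 0 := mul_neg_of_pos_of_neg (by linarith) hHS
  have h' : (S - t) * H s < 0 := lt_of_le_of_lt hconv this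
  exact (pos_iff_neg_of_mul_neg h').1 (by linarith)

/-! ### Comparison with the spectral radius -/

theorem le_spectralRadius {V : Type*} [Fintype V] (G : SimpleGraph V) {x : V → ℝ} (hx : x ≠ 0)
    {θ : ℝ} (h : ∀ v, ∑ w, (if G.Adj v w then x w else 0) = θ * x v) :
    θ ≤ spectralRadius G := by
  obtain ⟨v, -⟩ := Function.ne_iff.1 hx
  have : Nonempty V := ⟨v⟩
  refine (isGreatest_spectralRadius G).2
    (Module.End.hasEigenvalue_of_hasEigenvector (x := x) ⟨?_, hx⟩)
  rw [Module.End.mem_eigenspace_iff]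
  ext v
  simp [Matrix.toLin'_apply, Matrix.mulVec, dotProduct, SimpleGraph.adjMatrix_apply, h v]

/-- A positive supersolution of the eigenvalue equation for some `θ ≤ ρ(G)` on a connected graph is
a solution: pair it with the absolute value of an eigenvector for `ρ(G)`, which is a subsolution. -/
theorem adjacency_sum_eq_of_le {V : Type*} [Fintype V] {G : SimpleGraph V} (hG : G.Connected)
    {x : V → ℝ} (hx : ∀ v, 0 < x v) {θ : ℝ}
    (h : ∀ v, ∑ w, (if G.Adj v w then x w else 0) ≤ θ * x v) (hθ : θ ≤ spectralRadius G) (v : V) :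
    ∑ w, (if G.Adj v w then x w else 0) = θ * x v := by
  have : Nonempty V := ⟨v⟩
  obtain ⟨y, hy, hy0⟩ := (isGreatest_spectralRadius G).1.exists_hasEigenvector
  rw [Module.End.mem_eigenspace_iff] at hy
  have hy' : ∀ v, ∑ w, (if G.Adj v w then y w else 0) = spectralRadius G * y v := by
    intro v
    have := congrFun hy v
    simpa [Matrix.toLin'_apply, Matrix.mulVec, dotProduct, SimpleGraph.adjMatrix_apply] using this
  have hz : ∀ v, θ * |y v| ≤ ∑ w, (if G.Adj v w then |y w| else 0) := by
    intro v
    calc θ * |y v| ≤ |spectralRadius G| * |y v| :=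
          mul_le_mul_of_nonneg_right (hθ.trans (le_abs_self _)) (abs_nonneg _)
      _ = |∑ w, (if G.Adj v w then y w else 0)| := by rw [hy', abs_mul]
      _ ≤ ∑ w, |if G.Adj v w then y w else 0| := Finset.abs_sum_le_sum_abs _ _
      _ = _ := Finset.sum_congr rfl fun w _ => by split_ifs <;> simp
  have hswap : ∑ v, (∑ w, (if G.Adj v w then |y w| else 0)) * x v =
      ∑ v, |y v| * ∑ w, (if G.Adj v w then x w else 0) := by
    simp_rw [Finset.sum_mul, Finset.mul_sum]
    rw [Finset.sum_comm]
    refine Finset.sum_congr rfl fun v _ => Finset.sum_congr rfl fun w _ => ?_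
    simp only [G.adj_comm w v]
    split_ifs <;> simp
  have e1 : ∀ v ∈ Finset.univ,
      0 ≤ (∑ w, (if G.Adj v w then |y w| else 0) - θ * |y v|) * x v :=
    fun v _ => mul_nonneg (sub_nonneg.2 (hz v)) (hx v).le
  have e2 : ∀ v ∈ Finset.univ,
      0 ≤ |y v| * (θ * x v - ∑ w, (if G.Adj v w then x w else 0)) :=
    fun v _ => mul_nonneg (abs_nonneg _) (sub_nonneg.2 (h v))
  have hsum : ∑ v, (∑ w, (if G.Adj v w then |y w| else 0) - θ * |y v|) * x v +
      ∑ v, |y v| * (θ * x v - ∑ w, (if G.Adj v w then x w else 0)) = 0 := by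
    simp_rw [sub_mul, mul_sub, Finset.sum_sub_distrib]
    rw [hswap]
    have : ∀ v, θ * |y v| * x v = |y v| * (θ * x v) := fun v => by ring
    simp_rw [this]
    ring
  have n1 := Finset.sum_nonneg e1
  have n2 := Finset.sum_nonneg e2
  have z1 := (Finset.sum_eq_zero_iff_of_nonneg e1).1 (by linarith)
  have z2 := (Finset.sum_eq_zero_iff_of_nonneg e2).1 (by linarith)
  -- Thus `|y|` is an eigenvector, and its zero set is closed under adjacency.
  have hzero : ∀ a b, G.Adj a b → y a = 0 → y b = 0 := by
    intro a b hab ha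
    have := (mul_eq_zero.1 (z1 a (Finset.mem_univ a))).resolve_right (hx a).ne'
    rw [ha, abs_zero, mul_zero, sub_zero, Finset.sum_eq_zero_iff_of_nonneg
      (fun w _ => by split_ifs <;> simp)] at this
    simpa [hab] using this b (Finset.mem_univ b)
  have hyv : y v ≠ 0 := by
    intro hv
    refine hy0 (funext fun w => ?_)
    obtain ⟨p⟩ := hG.preconnected v w
    induction p with
    | nil => exact hv
    | cons hab _ ih => exact ih (hzero _ _ hab hv)
  have := (mul_eq_zero.1 (z2 v (Finset.mem_univ v))).resolve_left (abs_ne_zero.2 hyv)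
  linarith

/-! ### Sizes of the blocks -/

section Sizes

variable {κ : Type*} [Fintype κ] {m : κ → ℕ} {s n : ℕ}

theorem card_odd_eq (m : κ → ℕ) : (Finset.univ.filter fun C => Odd (m C)).card =
    (Finset.univ.filter fun C => m C = 1).card +
      (Finset.univ.filter fun C => Odd (m C) ∧ m C ≠ 1).card := by
  rw [← Finset.card_filter_add_card_filter_not (s := Finset.univ.filter fun C => Odd (m C))
    (fun C => m C = 1), Finset.filter_filter, Finset.filter_filter]
  congr 2
  ext C
  simp only [Finset.mem_filter, Finset.mem_univ, true_and, and_iff_right_iff_imp]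
  intro h
  rw [h]
  exact odd_one

/-- Odd blocks other than singletons have at least three vertices, which leaves at most
`n - 2s - 3` vertices for any single block. -/
theorem size_le (hsum : ∑ C, m C + s = n)
    (hone : (Finset.univ.filter fun C => m C = 1).card ≤ s)
    (hodd : s + 2 ≤ (Finset.univ.filter fun C => Odd (m C)).card) :
    2 * s + 6 ≤ n ∧ ∀ C, m C + (2 * s + 3) ≤ n := by
  have hw : ∀ C, (if m C = 1 then 1 else 0) + 3 * (if Odd (m C) ∧ m C ≠ 1 then 1 else 0) ≤ m C := by
    intro C
    by_cases h1 : m C = 1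
    · simp [h1]
    · by_cases h2 : Odd (m C)
      · obtain ⟨r, hr⟩ := h2
        simp only [h1, ↓reduceIte]
        split_ifs <;> omega
      · simp [h1, h2]
  have hw' : ∀ C, (if m C = 1 then 1 else 0) + 3 * (if Odd (m C) ∧ m C ≠ 1 then 1 else 0) ≤ 3 := by
    intro C
    split_ifs <;> simp_all
  have htot : s + 6 ≤
      ∑ C, ((if m C = 1 then 1 else 0) + 3 * (if Odd (m C) ∧ m C ≠ 1 then 1 else 0)) := by
    rw [Finset.sum_add_distrib, ← Finset.mul_sum, ← Finset.card_filter, ← Finset.card_filter]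
    have := card_odd_eq m
    omega
  have hle := Finset.sum_le_sum fun C (_ : C ∈ Finset.univ) => hw C
  refine ⟨by omega, fun C => ?_⟩
  rw [← Finset.add_sum_erase _ _ (Finset.mem_univ C)] at htot hsum
  have hle := Finset.sum_le_sum fun D (_ : D ∈ Finset.univ.erase C) => hw D
  have := hw' C
  omega

/-- The function `a / (c - a)` lies below its chord between `3` and `L` at the odd sizes `a ≥ 3`, and
below the line through the origin with the slope `c / ((c - L) (c - 3))` of that chord at the even
sizes; singletons are kept exactly. The bound is written as this line plus corrections, so that it
can be summed, and equality leaves only the sizes `1`, `3` and `L`. -/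
theorem ratio_le {c L : ℝ} {a : ℕ} (ha : 1 ≤ a) (haL : (a : ℝ) ≤ L) (hL3 : 3 ≤ L) (hc : L < c) :
    (a : ℝ) / (c - a) ≤ a * (c / ((c - L) * (c - 3))) +
      (if a = 1 then 1 / (c - 1) - c / ((c - L) * (c - 3)) else 0) +
      (if Odd a ∧ a ≠ 1 then 3 / (c - 3) - 3 * (c / ((c - L) * (c - 3))) else 0) ∧
    ((a : ℝ) / (c - a) = a * (c / ((c - L) * (c - 3))) +
      (if a = 1 then 1 / (c - 1) - c / ((c - L) * (c - 3)) else 0) +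
      (if Odd a ∧ a ≠ 1 then 3 / (c - 3) - 3 * (c / ((c - L) * (c - 3))) else 0) →
      Odd a ∧ (a = 1 ∨ a = 3 ∨ (a : ℝ) = L)) := by
  have hcL : 0 < c - L := by linarith
  have hc3 : 0 < c - 3 := by linarith
  have hca : 0 < c - a := by linarith
  by_cases h1 : a = 1
  · subst h1
    simp
  · by_cases h2 : Odd a
    · have h3 : (3 : ℝ) ≤ a := by
        obtain ⟨r, hr⟩ := h2
        exact_mod_cast (by omega : 3 ≤ a)
      have hid : a * (c / ((c - L) * (c - 3))) + (3 / (c - 3) - 3 * (c / ((c - L) * (c - 3)))) -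
          (a : ℝ) / (c - a) = c * ((a - 3) * (L - a)) / ((c - L) * (c - 3) * (c - a)) := by
        have := hcL.ne'
        have := hc3.ne'
        have := hca.ne'
        field_simp
        ring
      simp only [h1, h2, ↓reduceIte, ne_eq, not_false_eq_true, and_self, add_zero, true_and,
        false_or]
      constructor
      · rw [← sub_nonneg, hid]
        exact div_nonneg (mul_nonneg (by linarith) (mul_nonneg (by linarith) (by linarith)))
          (by positivity)
      · intro h
        rw [← h, sub_self, eq_comm, div_eq_zero_iff] at hid
        have : (L - a) = 0 ∨ (a : ℝ) - 3 = 0 := by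
          rcases hid with h | h
          · rcases mul_eq_zero.1 h with h | h
            · linarith
            · exact (mul_eq_zero.1 h).symm
          · exact absurd h (by positivity)
        rcases this with h | h
        · right; linarith
        · left; exact_mod_cast sub_eq_zero.1 h
    · have h0 : (0 : ℝ) < a := by exact_mod_cast ha
      have : (a : ℝ) / (c - a) < a * (c / ((c - L) * (c - 3))) := by
        rw [div_eq_mul_one_div]
        refine mul_lt_mul_of_pos_left ?_ h0
        rw [div_lt_div_iff₀ hca (by positivity)]
        nlinarith
      simp only [h1, h2, ↓reduceIte, false_and, add_zero]
      exact ⟨this.le, fun h => absurd h this.ne⟩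

/-- Among all block sizes with total `n - s`, with at most `s` singletons and at least `s + 2` odd
sizes, the sum of `a / (c - a)` is largest for `s` singletons, one block of size `3` and one block
of size `n - 2s - 3`, and only then. -/
theorem sum_ratio_le (hm : ∀ C, 1 ≤ m C) (hsum : ∑ C, m C + s = n)
    (hone : (Finset.univ.filter fun C => m C = 1).card ≤ s)
    (hodd : s + 2 ≤ (Finset.univ.filter fun C => Odd (m C)).card)
    {c : ℝ} (hc : (n : ℝ) - 2 * s - 3 < c) :
    ∑ C, (m C : ℝ) / (c - m C) ≤
      s / (c - 1) + 3 / (c - 3) + ((n : ℝ) - 2 * s - 3) / (c - ((n : ℝ) - 2 * s - 3)) ∧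
    (∑ C, (m C : ℝ) / (c - m C) =
      s / (c - 1) + 3 / (c - 3) + ((n : ℝ) - 2 * s - 3) / (c - ((n : ℝ) - 2 * s - 3)) →
      (Finset.univ.filter fun C => m C = 1).card = s ∧
        ∃ C₁ C₂, C₁ ≠ C₂ ∧ m C₁ + (2 * s + 3) = n ∧ m C₂ = 3 ∧
          ∀ C, C ≠ C₁ → C ≠ C₂ → m C = 1) := by
  obtain ⟨hn6, hmL⟩ := size_le hsum hone hodd
  have hcard := card_odd_eq m
  set i := (Finset.univ.filter fun C => m C = 1).card with hi
  set q := (Finset.univ.filter fun C => Odd (m C) ∧ m C ≠ 1).card with hq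
  set L : ℝ := (n : ℝ) - 2 * s - 3 with hLdef
  have hL3 : 3 ≤ L := by
    have : ((2 * s + 6 : ℕ) : ℝ) ≤ n := by exact_mod_cast hn6
    push_cast at this
    linarith
  have hmL' : ∀ C, (m C : ℝ) ≤ L := by
    intro C
    have : ((m C + (2 * s + 3) : ℕ) : ℝ) ≤ n := by exact_mod_cast hmL C
    push_cast at this
    linarith
  have hb := fun C => ratio_le (hm C) (hmL' C) hL3 hc
  set σ := c / ((c - L) * (c - 3)) with hσ
  have hcL : 0 < c - L := by linarith
  have hc3 : 0 < c - 3 := by linarith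
  have hc1 : 0 < c - 1 := by linarith
  have hsumb : ∑ C, ((m C : ℝ) * σ + (if m C = 1 then 1 / (c - 1) - σ else 0) +
      (if Odd (m C) ∧ m C ≠ 1 then 3 / (c - 3) - 3 * σ else 0)) =
      (n - s) * σ + i * (1 / (c - 1) - σ) + q * (3 / (c - 3) - 3 * σ) := by
    rw [Finset.sum_add_distrib, Finset.sum_add_distrib, ← Finset.sum_mul]
    rw [← Finset.sum_filter, ← Finset.sum_filter, Finset.sum_const, Finset.sum_const,
      nsmul_eq_mul, nsmul_eq_mul, ← hsum]
    push_cast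
    ring
  have p1 : 0 < 1 / (c - 1) + 2 * σ - 3 / (c - 3) := by
    have : 1 / (c - 1) + 2 * σ - 3 / (c - 3) =
        2 * c * (L - 1) / ((c - 1) * (c - 3) * (c - L)) := by
      have := hcL.ne'
      have := hc3.ne'
      have := hc1.ne'
      rw [hσ]
      field_simp
      ring
    rw [this]
    exact div_pos (mul_pos (by linarith) (by linarith)) (by positivity)
  have p2 : 0 < 3 * σ - 3 / (c - 3) := by
    have : 3 * σ - 3 / (c - 3) = 3 * L / ((c - L) * (c - 3)) := by
      have := hcL.ne'
      have := hc3.ne'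
      rw [hσ]
      field_simp
      ring
    rw [this]
    exact div_pos (by linarith) (by positivity)
  have hgL : L / (c - L) = 3 / (c - 3) + (L - 3) * σ := by
    have := hcL.ne'
    have := hc3.ne'
    rw [hσ]
    field_simp
    ring
  -- The gap is a nonnegative combination of the deficit of singletons and the surplus of odd sizes.
  have htarget : s / (c - 1) + 3 / (c - 3) + L / (c - L) =
      ((n - s) * σ + i * (1 / (c - 1) - σ) + q * (3 / (c - 3) - 3 * σ)) +
      ((s - i : ℝ) * (1 / (c - 1) + 2 * σ - 3 / (c - 3)) +
        ((i + q : ℝ) - (s + 2)) * (3 * σ - 3 / (c - 3))) := by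
    rw [hgL, show (n : ℝ) = L + 2 * s + 3 by rw [hLdef]; ring]
    ring
  have q1 : (0 : ℝ) ≤ s - i := sub_nonneg.2 (by exact_mod_cast hone)
  have q2 : (0 : ℝ) ≤ (i + q : ℝ) - (s + 2) := sub_nonneg.2 (by exact_mod_cast hcard ▸ hodd)
  have r1 := mul_nonneg q1 p1.le
  have r2 := mul_nonneg q2 p2.le
  have hle := Finset.sum_le_sum fun C (_ : C ∈ Finset.univ) => (hb C).1
  rw [hsumb] at hle
  refine ⟨by rw [htarget]; linarith, fun heq => ?_⟩
  have t1 : (s - i : ℝ) = 0 := by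
    have : (s - i : ℝ) * (1 / (c - 1) + 2 * σ - 3 / (c - 3)) = 0 := by linarith
    exact (mul_eq_zero.1 this).resolve_right p1.ne'
  have t2 : (i + q : ℝ) - (s + 2) = 0 := by
    have : ((i + q : ℝ) - (s + 2)) * (3 * σ - 3 / (c - 3)) = 0 := by linarith
    exact (mul_eq_zero.1 this).resolve_right p2.ne'
  have his : i = s := by exact_mod_cast (sub_eq_zero.1 t1).symm
  have hq2 : q = 2 := by
    have : i + q = s + 2 := by exact_mod_cast sub_eq_zero.1 t2
    omega
  have hall : ∀ C, Odd (m C) ∧ (m C = 1 ∨ m C = 3 ∨ (m C : ℝ) = L) := by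
    have := (Finset.sum_eq_sum_iff_of_le fun C (_ : C ∈ Finset.univ) => (hb C).1).1
      (by rw [hsumb]; linarith)
    exact fun C => (hb C).2 (this C (Finset.mem_univ C))
  refine ⟨his, ?_⟩
  have hfilter : (Finset.univ.filter fun C => Odd (m C) ∧ m C ≠ 1) =
      Finset.univ.filter fun C => ¬ m C = 1 :=
    Finset.filter_congr fun C _ => by simp [(hall C).1]
  obtain ⟨A, B, hAB, hset⟩ := Finset.card_eq_two.1 (hq ▸ hq2)
  rw [hfilter] at hset
  have hmem : ∀ C, ¬ m C = 1 ↔ C = A ∨ C = B := fun C => by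
    simpa using Finset.ext_iff.1 hset C
  have hABsum : m A + m B + 2 * s = n := by
    rw [← hsum, ← Finset.sum_filter_add_sum_filter_not Finset.univ (fun C => m C = 1), hset,
      Finset.sum_pair hAB, Finset.sum_congr rfl (fun C hC => (Finset.mem_filter.1 hC).2),
      Finset.sum_const, smul_eq_mul, mul_one]
    omega
  have hLnat : ∀ C, (m C : ℝ) = L → m C + (2 * s + 3) = n := by
    intro C h
    have : ((m C + (2 * s + 3) : ℕ) : ℝ) = n := by push_cast; linarith
    exact_mod_cast this
  have hA := (hall A).2.resolve_left ((hmem A).2 (Or.inl rfl))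
  have hrest : ∀ C, C ≠ A → C ≠ B → m C = 1 := fun C h1 h2 => by
    by_contra h
    exact ((hmem C).1 h).elim h1 h2
  rcases hA with hA | hA
  · exact ⟨B, A, hAB.symm, by omega, hA, fun C h1 h2 => hrest C h2 h1⟩
  · have := hLnat A hA
    exact ⟨A, B, hAB, this, by omega, hrest⟩

end Sizes

/-! ### Edge weights and matchings -/

/-- The symmetric matrix of an edge weighting: `f(vw)` at the adjacent pairs, `0` elsewhere. -/
noncomputable def edgeWeight {V R : Type*} [AddCommMonoid R] (G : SimpleGraph V)
    (f : G.edgeSet → R) (v w : V) : R :=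
  if h : G.Adj v w then f ⟨s(v, w), h⟩ else 0

theorem edgeWeight_comm {V R : Type*} [AddCommMonoid R] (G : SimpleGraph V)
    (f : G.edgeSet → R) (v w : V) : edgeWeight G f v w = edgeWeight G f w v := by
  unfold edgeWeight
  by_cases h : G.Adj v w
  · rw [dif_pos h, dif_pos h.symm]
    congr 2
    exact Sym2.eq_swap
  · rw [dif_neg h, dif_neg fun h' => h h'.symm]

theorem adj_of_edgeWeight_ne_zero {V R : Type*} [AddCommMonoid R] {G : SimpleGraph V}
    {f : G.edgeSet → R} {v w : V} (h : edgeWeight G f v w ≠ 0) : G.Adj v w := by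
  by_contra h'
  exact h (dif_neg h')

theorem incidentSum_eq {V R : Type*} [Fintype V] [AddCommMonoid R] (G : SimpleGraph V)
    (f : G.edgeSet → R) (v : V) : incidentSum G f v = ∑ w, edgeWeight G f v w := by
  rw [← Finset.sum_filter_of_ne (p := fun w => G.Adj v w)
    fun w _ h => adj_of_edgeWeight_ne_zero h, incidentSum]
  symm
  refine Finset.sum_bij (fun w hw => ⟨s(v, w), (Finset.mem_filter.1 hw).2⟩) ?_ ?_ ?_ ?_
  · intro w hw
    simp
  · intro w _ w' _ h
    exact Sym2.congr_right.1 (Subtype.ext_iff.1 h)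
  · rintro ⟨e, he⟩ h
    obtain ⟨w, rfl⟩ := (Finset.mem_filter.1 h).2
    exact ⟨w, Finset.mem_filter.2 ⟨Finset.mem_univ _, he⟩, rfl⟩
  · intro w hw
    exact dif_pos (Finset.mem_filter.1 hw).2

theorem hasPerfectKMatching_of_isPerfectMatching {V : Type*} [Fintype V] {G : SimpleGraph V}
    {M : G.Subgraph} (hM : M.IsPerfectMatching) (k : ℕ) : HasPerfectKMatching G k := by
  have hsum : ∀ v, incidentSum G (fun e => if (e : Sym2 V) ∈ M.edgeSet then k else 0) v = k := by
    intro v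
    obtain ⟨w, hw, huniq⟩ := SimpleGraph.Subgraph.isPerfectMatching_iff.1 hM v
    rw [incidentSum_eq, Finset.sum_eq_single w]
    · simp [edgeWeight, hw.adj_sub, hw]
    · intro b _ hb
      by_cases h : G.Adj v b
      · have hMb : ¬ M.Adj v b := fun h' => hb (huniq b h')
        simp [edgeWeight, h, hMb]
      · simp [edgeWeight, h]
    · simp
  exact ⟨_, ⟨fun e => by split_ifs <;> simp, fun v => (hsum v).le⟩, hsum⟩

/-- Every vertex of `I` has all its neighbours in `U`, so the total weight `|I|` at `I` is absorbed
by the capacity `|U|` of `U`. -/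
theorem card_le_of_hasFractionalPerfectMatching {V : Type*} [Fintype V] {G : SimpleGraph V}
    (h : HasFractionalPerfectMatching G) {I U : Finset V}
    (hIU : ∀ v ∈ I, ∀ w, G.Adj v w → w ∈ U) : I.card ≤ U.card := by
  obtain ⟨f, hf, hsum⟩ := h
  simp_rw [incidentSum_eq] at hsum
  have hnn : ∀ v w, 0 ≤ edgeWeight G f v w := by
    intro v w
    unfold edgeWeight
    split_ifs
    · exact (hf _).1
    · exact le_rfl
  have : (I.card : ℝ) ≤ U.card := by
    calc (I.card : ℝ) = ∑ v ∈ I, ∑ w, edgeWeight G f v w := by simp [hsum]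
      _ = ∑ v ∈ I, ∑ w ∈ U, edgeWeight G f v w := by
          refine Finset.sum_congr rfl fun v hv => ?_
          refine (Finset.sum_subset (Finset.subset_univ U) fun w _ hw => ?_).symm
          by_contra h
          exact hw (hIU v hv w (adj_of_edgeWeight_ne_zero h))
      _ = ∑ w ∈ U, ∑ v ∈ I, edgeWeight G f w v := by
          rw [Finset.sum_comm]
          exact Finset.sum_congr rfl fun w _ => Finset.sum_congr rfl fun v _ =>
            edgeWeight_comm G f v w
      _ ≤ ∑ w ∈ U, ∑ v, edgeWeight G f w v :=
          Finset.sum_le_sum fun w _ => Finset.sum_le_sum_of_subset_of_nonneg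
            (Finset.subset_univ I) fun v _ _ => hnn w v
      _ = U.card := by simp [hsum]
  exact_mod_cast this

/-! ### The extremal graph -/

/-- The class of a vertex of the extremal graph: `0` for `K_t`, `1` for `K_{n-2t-3}`, `2` for
`K_3` and `3` for `tK_1`. -/
def extremalClass (n t : ℕ) : Fin t ⊕ ((Fin (n - 2 * t - 3) ⊕ Fin 3) ⊕ Fin t) → Fin 4 :=
  Sum.elim (fun _ => 0) (Sum.elim (Sum.elim (fun _ => 1) fun _ => 2) fun _ => 3)

/-- Adjacency of distinct vertices of the extremal graph in terms of their classes. -/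
def ClassRel (a b : Fin 4) : Prop := a = 0 ∨ b = 0 ∨ (a = b ∧ a ≠ 3)

theorem extremalGraph_adj (n t : ℕ) (a b) : (extremalGraph n t).Adj a b ↔
    a ≠ b ∧ ClassRel (extremalClass n t a) (extremalClass n t b) := by
  rcases a with a | (a | a) | a <;> rcases b with b | (b | b) | b <;>
    simp [extremalGraph, join, extremalClass, ClassRel, K]

/-- The `t` isolated vertices use up all the weight at `K_t`, so the triangle would have to carry a
total vertex weight `3k`, which is twice its edge weight, although `k` is odd. -/
theorem not_exists_weight_extremalGraph {n t k : ℕ} (hk : Odd k) (F : _ → _ → ℕ)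
    (hsymm : ∀ a b, F a b = F b a) (hF : ∀ a b, F a b ≠ 0 → (extremalGraph n t).Adj a b)
    (hsum : ∀ a, ∑ b, F a b = k) : False := by
  simp only [Fintype.sum_sum_type] at hsum
  have h0 : ∀ a b, ¬ (extremalGraph n t).Adj a b → F a b = 0 := fun a b h => by
    by_contra h'
    exact h (hF a b h')
  simp only [extremalGraph_adj] at h0
  have hI : ∀ a : Fin t, ∑ u : Fin t, F (.inr (.inr a)) (.inl u) = k := by
    intro a
    have := hsum (.inr (.inr a))
    rwa [Finset.sum_eq_zero (s := Finset.univ) (f := fun x : Fin t => F (.inr (.inr a))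
        (.inr (.inr x))) fun x _ => h0 _ _ (by simp [extremalClass, ClassRel]),
      Finset.sum_eq_zero (s := Finset.univ) (f := fun x : Fin 3 => F (.inr (.inr a))
        (.inr (.inl (.inr x)))) fun x _ => h0 _ _ (by simp [extremalClass, ClassRel]),
      Finset.sum_eq_zero (s := Finset.univ) (f := fun x : Fin (n - 2 * t - 3) =>
        F (.inr (.inr a)) (.inr (.inl (.inl x)))) fun x _ => h0 _ _
          (by simp [extremalClass, ClassRel]), add_zero, add_zero, add_zero] at this
  have hUI : ∑ u : Fin t, ∑ a : Fin t, F (.inl u) (.inr (.inr a)) = t * k := by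
    rw [Finset.sum_comm]
    simp_rw [hsymm (.inl _) (.inr (.inr _)), hI]
    simp
  have hU := Finset.sum_congr rfl fun (u : Fin t) (_ : u ∈ Finset.univ) => hsum (.inl u)
  simp only [Finset.sum_add_distrib, hUI, Finset.sum_const, Finset.card_univ, Fintype.card_fin,
    smul_eq_mul] at hU
  have hU3 : ∑ u : Fin t, ∑ x : Fin 3, F (.inl u) (.inr (.inl (.inr x))) = 0 := by omega
  have h3U : ∀ (x : Fin 3) (u : Fin t), F (.inr (.inl (.inr x))) (.inl u) = 0 := by
    intro x u
    rw [hsymm]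
    exact (Finset.sum_eq_zero_iff.1 (Finset.sum_eq_zero_iff.1 hU3 u (Finset.mem_univ u))) x
      (Finset.mem_univ x)
  have h3 : ∀ x : Fin 3, ∑ y : Fin 3, F (.inr (.inl (.inr x))) (.inr (.inl (.inr y))) = k := by
    intro x
    have := hsum (.inr (.inl (.inr x)))
    rwa [Finset.sum_eq_zero (s := Finset.univ) (f := fun u : Fin t => F (.inr (.inl (.inr x)))
        (.inl u)) fun u _ => h3U x u,
      Finset.sum_eq_zero (s := Finset.univ) (f := fun y : Fin t => F (.inr (.inl (.inr x)))
        (.inr (.inr y))) fun y _ => h0 _ _ (by simp [extremalClass, ClassRel]),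
      Finset.sum_eq_zero (s := Finset.univ) (f := fun y : Fin (n - 2 * t - 3) =>
        F (.inr (.inl (.inr x))) (.inr (.inl (.inl y)))) fun y _ => h0 _ _
          (by simp [extremalClass, ClassRel]), add_zero, zero_add, zero_add] at this
  have hd : ∀ a, F a a = 0 := fun a => h0 _ _ (by simp)
  have e0 := h3 0
  have e1 := h3 1
  have e2 := h3 2
  simp only [Fin.sum_univ_three, hd] at e0 e1 e2
  have s1 := hsymm (.inr (.inl (.inr 1))) (.inr (.inl (.inr 0)))
  have s2 := hsymm (.inr (.inl (.inr 2))) (.inr (.inl (.inr 0)))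
  have s3 := hsymm (.inr (.inl (.inr 2))) (.inr (.inl (.inr 1)))
  obtain ⟨r, rfl⟩ := hk
  omega

theorem not_hasPerfectKMatching_of_iso {V : Type*} [Fintype V] {G : SimpleGraph V} {n t k : ℕ}
    (hk : Odd k) (e : G ≃g extremalGraph n t) : ¬ HasPerfectKMatching G k := by
  rintro ⟨f, -, hf⟩
  simp_rw [incidentSum_eq] at hf
  refine not_exists_weight_extremalGraph (n := n) (t := t) hk
    (fun a b => edgeWeight G f (e.symm a) (e.symm b)) (fun a b => edgeWeight_comm _ _ _ _)
    (fun a b h => e.symm.map_adj_iff.1 (adj_of_edgeWeight_ne_zero h)) fun a => ?_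
  rw [← hf (e.symm a)]
  exact Equiv.sum_comp e.symm.toEquiv (fun w => edgeWeight G f (e.symm a) w)

theorem nonempty_iso_of_class {V W ι : Type*} [Fintype V] [Fintype W] [DecidableEq ι] {G : SimpleGraph V}
    {H : SimpleGraph W} (p : V → ι) (q : W → ι) (r : ι → ι → Prop)
    (hG : ∀ a b, G.Adj a b ↔ a ≠ b ∧ r (p a) (p b)) (hH : ∀ a b, H.Adj a b ↔ a ≠ b ∧ r (q a) (q b))
    (hcard : ∀ i, (Finset.univ.filter fun v => p v = i).card =
      (Finset.univ.filter fun w => q w = i).card) : Nonempty (G ≃g H) := by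
  have hfib : ∀ i, Nonempty ({v // p v = i} ≃ {w // q w = i}) := fun i => by
    rw [← Fintype.card_eq, Fintype.card_subtype, Fintype.card_subtype, hcard]
  let e : V ≃ W := (Equiv.sigmaFiberEquiv p).symm.trans
    ((Equiv.sigmaCongrRight fun i => (hfib i).some).trans (Equiv.sigmaFiberEquiv q))
  have he : ∀ v, q (e v) = p v := fun v => ((hfib (p v)).some ⟨v, rfl⟩).2
  exact ⟨⟨e, by intro a b; rw [hG, hH, he, he, e.injective.ne_iff]⟩⟩

/-! ### Blocks of a Tutte violator -/

/-- The blocks of `V ∖ U` are the components left by a Tutte violator `U`; the values of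
`comp` on `U` are irrelevant. -/
theorem exists_odd_components_of_no_perfectMatching {V : Type u} [Fintype V] {G : SimpleGraph V}
    (h : ¬ ∃ M : G.Subgraph, M.IsPerfectMatching) :
    ∃ (U : Finset V) (κ : Type u) (_ : Fintype κ) (comp : V → κ),
      (∀ C, ∃ v, v ∉ U ∧ comp v = C) ∧
      (∀ v w, v ∉ U → w ∉ U → G.Adj v w → comp v = comp w) ∧
      U.card < (Finset.univ.filter fun C =>
        Odd (Finset.univ.filter fun v => v ∉ U ∧ comp v = C).card).card := by
  rw [SimpleGraph.tutte] at h
  push Not at h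
  obtain ⟨u, hu⟩ := h
  rw [SimpleGraph.IsTutteViolator] at hu
  set H := ((⊤ : G.Subgraph).deleteVerts u).coe with hH
  obtain ⟨C₀, -⟩ : H.oddComponents.Nonempty := by
    rw [← Set.ncard_pos]
    omega
  have hmem : ∀ v, v ∈ ((⊤ : G.Subgraph).deleteVerts u).verts ↔ v ∉ u.toFinset := by
    intro v
    simp
  let comp : V → H.ConnectedComponent := fun v =>
    if h : v ∈ ((⊤ : G.Subgraph).deleteVerts u).verts then H.connectedComponentMk ⟨v, h⟩ else C₀
  have hcomp : ∀ v : ((⊤ : G.Subgraph).deleteVerts u).verts,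
      comp v = H.connectedComponentMk v := fun v => dif_pos v.2
  refine ⟨u.toFinset, H.ConnectedComponent, inferInstance, comp, ?_, ?_, ?_⟩
  · intro C
    obtain ⟨v, rfl⟩ := C.exists_rep
    exact ⟨v, (hmem _).1 v.2, hcomp v⟩
  · intro v w hv hw hvw
    rw [hcomp ⟨v, (hmem v).2 hv⟩, hcomp ⟨w, (hmem w).2 hw⟩]
    refine SimpleGraph.ConnectedComponent.sound (SimpleGraph.Adj.reachable ?_)
    rw [hH, SimpleGraph.Subgraph.coe_adj, SimpleGraph.Subgraph.deleteVerts_adj]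
    simp at hv hw
    simp [hv, hw, hvw]
  · have hsize : ∀ C : H.ConnectedComponent, C.supp.ncard =
        (Finset.univ.filter fun v => v ∉ u.toFinset ∧ comp v = C).card := by
      intro C
      rw [← Set.ncard_image_of_injective _ Subtype.val_injective, ← Set.ncard_coe_finset]
      congr 1
      ext v
      simp only [Set.mem_image, Finset.coe_filter, Finset.mem_univ, true_and, Set.mem_ofPred_eq,
        SimpleGraph.ConnectedComponent.mem_supp_iff]
      constructor
      · rintro ⟨x, hx, rfl⟩
        exact ⟨(hmem _).1 x.2, (hcomp x).trans hx⟩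
      · rintro ⟨h1, h2⟩
        exact ⟨⟨v, (hmem v).2 h1⟩, (hcomp _).symm.trans h2, rfl⟩
    have hodd : H.oddComponents.ncard = (Finset.univ.filter fun C =>
        Odd (Finset.univ.filter fun v => v ∉ u.toFinset ∧ comp v = C).card).card := by
      rw [← Set.ncard_coe_finset]
      congr 1
      ext C
      simp only [Finset.coe_filter, Finset.mem_univ, true_and, Set.mem_ofPred_eq, ← hsize]
    rw [← Set.ncard_eq_toFinset_card']
    exact hu.trans_eq hodd

theorem comp_eq_of_connected {V κ : Type*} {G : SimpleGraph V} {U : Finset V} {comp : V → κ}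
    (hadj : ∀ v w, v ∉ U → w ∉ U → G.Adj v w → comp v = comp w)
    (hconn : (G.induce {v | v ∉ U}).Connected) {v w : V} (hv : v ∉ U) (hw : w ∉ U) :
    comp v = comp w := by
  obtain ⟨p⟩ := hconn.preconnected ⟨v, hv⟩ ⟨w, hw⟩
  have : ∀ a b : {v | v ∉ U}, (G.induce {v | v ∉ U}).Walk a b → comp a = comp b := by
    intro a b p
    induction p with
    | nil => rfl
    | @cons a b _ h _ ih => exact (hadj a b a.2 b.2 h).trans ih
  exact this _ _ p

/-! ### Spectral radius of the extremal graph -/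

/-- A root `c` of the quotient equation gives the eigenvalue `c - 1` of the extremal graph, with an
eigenvector that is constant on the four parts. -/
theorem le_spectralRadius_extremalGraph {n t : ℕ} (ht : 1 ≤ t) (hnt : 5 * t + 7 ≤ n) {c : ℝ}
    (hc : (n : ℝ) - t - 3 ≤ c)
    (hroot : (t : ℝ) - c + t * (t / (c - 1) + 3 / (c - 3) +
      ((n : ℝ) - 2 * t - 3) / (c - ((n : ℝ) - 2 * t - 3))) = 0) :
    c - 1 ≤ spectralRadius (extremalGraph n t) := by
  have ht' : (1 : ℝ) ≤ t := by exact_mod_cast ht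
  have hnt' : (5 : ℝ) * t + 7 ≤ n := by exact_mod_cast hnt
  have hL : ((n - 2 * t - 3 : ℕ) : ℝ) = (n : ℝ) - 2 * t - 3 := by
    rw [Nat.sub_sub, Nat.cast_sub (by omega)]
    push_cast
    ring
  have h1 : c - 1 ≠ 0 := ne_of_gt (by linarith)
  have h3 : c - 3 ≠ 0 := ne_of_gt (by linarith)
  have h4 : c - ((n : ℝ) - 2 * t - 3) ≠ 0 := ne_of_gt (by linarith)
  let x : Fin t ⊕ ((Fin (n - 2 * t - 3) ⊕ Fin 3) ⊕ Fin t) → ℝ :=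
    Sum.elim (fun _ => 1) (Sum.elim (Sum.elim (fun _ => t / (c - ((n : ℝ) - 2 * t - 3)))
      fun _ => t / (c - 3)) fun _ => t / (c - 1))
  have hcomplete : ∀ (m : ℕ) (i : Fin m) (a : ℝ),
      ∑ j : Fin m, (if i = j then 0 else a) = m * a - a := by
    intro m i a
    have : ∀ j, (if i = j then 0 else a) = a - if i = j then a else 0 := fun j => by
      split_ifs <;> simp
    simp_rw [this, Finset.sum_sub_distrib]
    simp
  refine le_spectralRadius _ (x := x) (fun h => ?_) fun v => ?_
  · have := congrFun h (.inl ⟨0, ht⟩)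
    simp [x] at this
  · simp only [extremalGraph_adj, Fintype.sum_sum_type]
    rcases v with v | (v | v) | v <;>
      simp [x, extremalClass, ClassRel, hcomplete, ite_not, hL]
    · linear_combination hroot
    · generalize (n : ℝ) - 2 * t - 3 = L at h4 ⊢
      field_simp
      ring
    · field_simp
      ring
    · field_simp

/-! ### The test vector of a cut -/

/-- Let the blocks `comp v = C` of `V ∖ U` have no edges between them. The vector with value `1` on
`U` and `|U| / (c - m C)` on a block of size `m C` solves the eigenvalue equations for `c - 1` off
`U` when all edges within blocks and at `U` are present, and then its defect at the vertices of `U`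
is the left side of `hle`. So if that is nonpositive and `c - 1 ≤ ρ(G)`, it vanishes and no such
edge is missing. -/
theorem complete_of_le_spectralRadius {V κ : Type*} [Fintype V] [Fintype κ] {G : SimpleGraph V}
    (hG : G.Connected) {U : Finset V} {comp : V → κ} {m : κ → ℕ}
    (hmdef : ∀ C, m C = (Finset.univ.filter fun v => v ∉ U ∧ comp v = C).card)
    (hadj : ∀ v w, v ∉ U → w ∉ U → G.Adj v w → comp v = comp w)
    {c : ℝ} (hmc : ∀ C, (m C : ℝ) < c)
    (hU : U.Nonempty)
    (hle : (U.card : ℝ) - c + U.card * ∑ C, (m C : ℝ) / (c - m C) ≤ 0)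
    (hρ : c - 1 ≤ spectralRadius G) :
    (U.card : ℝ) - c + U.card * ∑ C, (m C : ℝ) / (c - m C) = 0 ∧
      ∀ v w, v ≠ w → v ∈ U ∨ w ∈ U ∨ comp v = comp w → G.Adj v w := by
  set x : V → ℝ := fun v => if v ∈ U then 1 else U.card / (c - m (comp v)) with hx
  have hs : (0 : ℝ) < U.card := by exact_mod_cast hU.card_pos
  have hxpos : ∀ v, 0 < x v := by
    intro v
    simp only [hx]
    split_ifs
    · exact one_pos
    · exact div_pos hs (sub_pos.2 (hmc _))
  have hxU : ∑ v ∈ U, x v = U.card := by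
    rw [Finset.sum_congr rfl fun v hv => if_pos hv]
    simp
  have hblock : ∀ C, ∑ v with v ∉ U ∧ comp v = C, x v = m C * (U.card / (c - m C)) := by
    intro C
    rw [Finset.sum_congr rfl (g := fun _ => (U.card : ℝ) / (c - m C)), Finset.sum_const,
      nsmul_eq_mul, hmdef C]
    intro v hv
    obtain ⟨h1, h2⟩ := (Finset.mem_filter.1 hv).2
    simp only [hx, if_neg h1, h2]
  have hxtotal : ∑ v, x v = U.card + U.card * ∑ C, (m C : ℝ) / (c - m C) := by
    rw [← Finset.sum_filter_add_sum_filter_not Finset.univ (· ∈ U)]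
    congr 1
    · rw [Finset.filter_mem_eq_inter, Finset.univ_inter, hxU]
    · rw [← Finset.sum_fiberwise (Finset.univ.filter (· ∉ U)) comp x, Finset.mul_sum]
      refine Finset.sum_congr rfl fun C _ => ?_
      rw [Finset.filter_filter, hblock C]
      ring
  -- The neighbours that a vertex may have when nothing joins distinct blocks.
  let N : V → V → Prop := fun v w => v ≠ w ∧ (v ∈ U ∨ w ∈ U ∨ comp v = comp w)
  have hAN : ∀ v w, G.Adj v w → N v w := by
    intro v w h
    refine ⟨h.ne, ?_⟩
    by_cases hv : v ∈ U
    · exact Or.inl hv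
    · by_cases hw : w ∈ U
      · exact Or.inr (Or.inl hw)
      · exact Or.inr (Or.inr (hadj v w hv hw h))
  have hterm : ∀ v w, (if G.Adj v w then x w else 0) ≤ if N v w then x w else 0 := by
    intro v w
    by_cases h : G.Adj v w
    · rw [if_pos h, if_pos (hAN v w h)]
    · rw [if_neg h]
      split_ifs
      exacts [(hxpos w).le, le_rfl]
  have hNU : ∀ v ∈ U, ∑ w, (if N v w then x w else 0) =
      (U.card - c + U.card * ∑ C, (m C : ℝ) / (c - m C)) + (c - 1) * x v := by
    intro v hv
    have : ∀ w, (if N v w then x w else 0) = x w - if v = w then x w else 0 := by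
      intro w
      by_cases h : v = w <;> simp [N, h, hv]
    simp_rw [this, Finset.sum_sub_distrib, hxtotal]
    simp [hx, hv]
    ring
  have hNC : ∀ v ∉ U, ∑ w, (if N v w then x w else 0) = (c - 1) * x v := by
    intro v hv
    have : ∀ w, (if N v w then x w else 0) = (if w ∈ U then x w else 0) +
        (if w ∉ U ∧ comp w = comp v then x w else 0) - if v = w then x w else 0 := by
      intro w
      by_cases h : v = w
      · subst h
        simp [N, hv]
      · by_cases hw : w ∈ U <;> simp [N, h, hv, hw, eq_comm]
    simp_rw [this, Finset.sum_sub_distrib, Finset.sum_add_distrib]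
    rw [← Finset.sum_filter, ← Finset.sum_filter, hblock, Finset.filter_mem_eq_inter,
      Finset.univ_inter, hxU]
    have := (sub_pos.2 (hmc (comp v))).ne'
    simp [hx, hv]
    field_simp
    ring
  have hNle : ∀ v, ∑ w, (if N v w then x w else 0) ≤ (c - 1) * x v := by
    intro v
    by_cases hv : v ∈ U
    · rw [hNU v hv]
      linarith
    · exact (hNC v hv).le
  have hsuper : ∀ v, ∑ w, (if G.Adj v w then x w else 0) ≤ (c - 1) * x v := fun v =>
    (Finset.sum_le_sum fun w _ => hterm v w).trans (hNle v)
  have heq := adjacency_sum_eq_of_le hG hxpos hsuper hρ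
  have hsumeq : ∀ v, ∑ w, (if G.Adj v w then x w else 0) = ∑ w, if N v w then x w else 0 :=
    fun v => le_antisymm (Finset.sum_le_sum fun w _ => hterm v w) ((hNle v).trans (heq v).ge)
  constructor
  · obtain ⟨u, hu⟩ := hU
    have := hNU u hu
    rw [← hsumeq, heq] at this
    linarith
  · intro v w hvw h
    have := (Finset.sum_eq_sum_iff_of_le fun w _ => hterm v w).1 (hsumeq v) w (Finset.mem_univ w)
    by_contra hno
    rw [if_neg hno, if_pos ⟨hvw, h⟩] at this
    exact (hxpos w).ne this

/-! ### Recognizing the extremal graph -/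

/-- The sizes of `U` and of two blocks determine the graph once all edges within blocks and at `U`
are present: the remaining `t` vertices form singleton blocks. -/
theorem iso_extremalGraph_of_blocks {V κ : Type*} [Fintype V] [Fintype κ] {G : SimpleGraph V}
    {n t : ℕ} (hcard : Fintype.card V = n) {U : Finset V} (hUt : U.card = t) {comp : V → κ}
    {m : κ → ℕ} (hmdef : ∀ C, m C = (Finset.univ.filter fun v => v ∉ U ∧ comp v = C).card)
    (hadj : ∀ v w, v ∉ U → w ∉ U → G.Adj v w → comp v = comp w)
    (hfull : ∀ v w, v ≠ w → v ∈ U ∨ w ∈ U ∨ comp v = comp w → G.Adj v w)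
    {C₁ C₂ : κ} (hne : C₁ ≠ C₂) (h₁ : m C₁ + (2 * t + 3) = n) (h₂ : m C₂ = 3)
    (hrest : ∀ C, C ≠ C₁ → C ≠ C₂ → m C = 1) : Nonempty (G ≃g extremalGraph n t) := by
  let p : V → Fin 4 := fun v =>
    if v ∈ U then 0 else if comp v = C₁ then 1 else if comp v = C₂ then 2 else 3
  have hsingle : ∀ v w, v ∉ U → w ∉ U → p v = 3 → comp v = comp w → v = w := by
    intro v w hv hw hp h
    have hmv : m (comp v) = 1 := by
      refine hrest _ (fun h' => ?_) fun h' => ?_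
      · simp [p, hv, h'] at hp
      · simp [p, hv, h', hne.symm] at hp
    rw [hmdef] at hmv
    exact Finset.card_le_one.1 hmv.le v (by simp [hv]) w (by simp [hw, h])
  have hrel : ∀ v w, v ≠ w →
      (ClassRel (p v) (p w) ↔ (v ∈ U ∨ w ∈ U ∨ comp v = comp w)) := by
    intro v w hvw
    by_cases hv : v ∈ U
    · simp [ClassRel, p, hv]
    by_cases hw : w ∈ U
    · simp [ClassRel, p, hw]
    have hp : ∀ z ∉ U, p z ≠ 0 := by
      intro z hz
      simp only [p, if_neg hz]
      split_ifs <;> decide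
    simp only [ClassRel, hp v hv, hp w hw, hv, hw, false_or]
    constructor
    · rintro ⟨h, h3⟩
      simp only [p, if_neg hv, if_neg hw] at h h3
      split_ifs at h h3 with a1 a2 a3 a4 a5 a6 <;> simp_all
    · intro h
      refine ⟨by simp only [p, if_neg hv, if_neg hw, h], fun h3 => ?_⟩
      exact hvw (hsingle v w hv hw h3 h)
  have c0 : (Finset.univ.filter fun v => p v = 0).card = t := by
    rw [← hUt]
    congr 1
    ext v
    simp only [Finset.mem_filter, Finset.mem_univ, true_and, p]
    by_cases hv : v ∈ U
    · simp [hv]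
    · simp only [hv, if_false, iff_false]
      split_ifs <;> decide
  have c1 : (Finset.univ.filter fun v => p v = 1).card = n - 2 * t - 3 := by
    rw [show n - 2 * t - 3 = m C₁ by omega, hmdef]
    congr 1
    ext v
    simp only [Finset.mem_filter, Finset.mem_univ, true_and, p]
    by_cases hv : v ∈ U
    · simp [hv]
    · by_cases h : comp v = C₁
      · simp [hv, h]
      · simp only [hv, h, if_false, and_false, iff_false]
        split_ifs <;> decide
  have c2 : (Finset.univ.filter fun v => p v = 2).card = 3 := by
    refine Eq.trans ?_ h₂
    rw [hmdef]
    congr 1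
    ext v
    simp only [Finset.mem_filter, Finset.mem_univ, true_and, p]
    by_cases hv : v ∈ U
    · simp [hv]
    · by_cases h : comp v = C₁
      · simp [hv, h, hne]
      · by_cases h' : comp v = C₂ <;> simp [hv, h, h', hne.symm]
  have c3 : (Finset.univ.filter fun v => p v = 3).card = t := by
    have := Finset.card_eq_sum_card_fiberwise (s := Finset.univ) (t := Finset.univ) (f := p)
      (fun _ _ => Finset.mem_coe.2 (Finset.mem_univ _))
    rw [Fin.sum_univ_four, c0, c1, c2, Finset.card_univ, hcard] at this
    omega
  refine nonempty_iso_of_class p (extremalClass n t) ClassRel (fun v w => ?_)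
    (extremalGraph_adj n t) fun i => ?_
  · by_cases h : v = w
    · simp [h]
    · rw [hrel v w h]
      refine ⟨fun hvw => ⟨h, ?_⟩, fun hvw => hfull v w h hvw.2⟩
      by_cases hv : v ∈ U
      · exact Or.inl hv
      · by_cases hw : w ∈ U
        · exact Or.inr (Or.inl hw)
        · exact Or.inr (Or.inr (hadj v w hv hw hvw))
  · have hq : ∀ i, (Finset.univ.filter fun w => extremalClass n t w = i).card =
        ![t, n - 2 * t - 3, 3, t] i := by
      intro i
      rw [Finset.card_filter, Fintype.sum_sum_type, Fintype.sum_sum_type, Fintype.sum_sum_type]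
      fin_cases i <;> simp [extremalClass]
    rw [hq]
    fin_cases i
    exacts [c0, c1, c2, c3]

/-! ### Perfect matchings -/

/-- The case `k = 1`, which implies the others since a perfect matching can be multiplied by `k`. -/
theorem exists_isPerfectMatching_or_iso {V : Type*} [Fintype V] {G : SimpleGraph V} {t n : ℕ}
    (ht : 1 ≤ t) (hcard : Fintype.card V = n) (hn : Even n) (hnt : 5 * t + 7 ≤ n)
    (hconn : IsTConnected G t) (hfrac : HasFractionalPerfectMatching G)
    (hρ : spectralRadius (extremalGraph n t) ≤ spectralRadius G) :
    (∃ M : G.Subgraph, M.IsPerfectMatching) ∨ Nonempty (G ≃g extremalGraph n t) := by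
  refine or_iff_not_imp_left.2 fun hno => ?_
  obtain ⟨U, κ, _, comp, hsurj, hadj, hodd⟩ := exists_odd_components_of_no_perfectMatching hno
  set m : κ → ℕ := fun C => (Finset.univ.filter fun v => v ∉ U ∧ comp v = C).card with hm
  set s := U.card with hs
  have hm1 : ∀ C, 1 ≤ m C := by
    intro C
    obtain ⟨v, hv, hvC⟩ := hsurj C
    exact Finset.card_pos.2 ⟨v, by simp [hv, hvC]⟩
  have hsum : ∑ C, m C + s = n := by
    have h1 := Finset.card_eq_sum_card_fiberwise (s := Finset.univ.filter fun v => v ∉ U)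
      (t := Finset.univ) (f := comp) (fun _ _ => Finset.mem_coe.2 (Finset.mem_univ _))
    simp_rw [Finset.filter_filter] at h1
    change _ = ∑ C, m C at h1
    have h2 := Finset.card_filter_add_card_filter_not (s := (Finset.univ : Finset V)) (· ∈ U)
    rw [Finset.filter_mem_eq_inter, Finset.univ_inter, Finset.card_univ, hcard, h1] at h2
    omega
  have hodd2 : s + 2 ≤ (Finset.univ.filter fun C => Odd (m C)).card := by
    have h1 := Finset.odd_sum_iff_odd_card_odd (s := Finset.univ) m
    have h2 : s + 1 ≤ (Finset.univ.filter fun C => Odd (m C)).card := hodd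
    rcases h2.lt_or_eq with h | h
    · exact h
    · exfalso
      rw [← h] at h1
      rw [← hsum] at hn
      grind
  -- A singleton block is an isolated vertex of `G - U`, all of whose neighbours lie in `U`.
  have hone : (Finset.univ.filter fun C => m C = 1).card ≤ s := by
    choose rep hrep hrepC using hsurj
    rw [← Finset.card_image_of_injective (Finset.univ.filter fun C => m C = 1) (f := rep)
      fun C D h => by rw [← hrepC C, ← hrepC D, h]]
    refine card_le_of_hasFractionalPerfectMatching hfrac fun v hv w hvw => ?_
    obtain ⟨C, hC, rfl⟩ := Finset.mem_image.1 hv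
    by_contra hw
    have hCw := hadj _ _ (hrep C) hw hvw
    exact hvw.ne (Finset.card_le_one.1 (Finset.mem_filter.1 hC).2.le _ (by simp [hrep, hrepC])
      _ (by simp [hw, hCw.symm.trans (hrepC C)]))
  -- There are at least two blocks, so `U` separates `G`.
  have hts : t ≤ s := by
    by_contra hlt
    obtain ⟨C, -, D, -, hCD⟩ := Finset.one_lt_card.1 (by omega :
      1 < (Finset.univ.filter fun C => Odd (m C)).card)
    obtain ⟨v, hv, rfl⟩ := hsurj C
    obtain ⟨w, hw, rfl⟩ := hsurj D
    exact hCD (comp_eq_of_connected hadj (hconn.2 U (not_le.1 hlt)) hv hw)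
  -- Deleting no vertex at all shows that `G` itself is connected.
  have hG : G.Connected := by
    have h := hconn.2 ∅ (by rwa [Finset.card_empty])
    have hV : Nonempty V := ⟨h.nonempty.some.1⟩
    refine ⟨fun v w => ?_⟩
    exact (h.preconnected ⟨v, by simp⟩ ⟨w, by simp⟩).map (SimpleGraph.Embedding.induce _).toHom
  obtain ⟨hn6, hmL⟩ := size_le hsum hone hodd2
  have ht' : (1 : ℝ) ≤ t := by exact_mod_cast ht
  have hnt' : (5 : ℝ) * t + 7 ≤ n := by exact_mod_cast hnt
  have hts' : (t : ℝ) ≤ s := by exact_mod_cast hts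
  have hn6' : (2 : ℝ) * s + 6 ≤ n := by exact_mod_cast hn6
  obtain ⟨c, hc1, hc2, hc3, hroot⟩ := exists_root_equation ht' hnt'
  have hcρ := (le_spectralRadius_extremalGraph ht hnt hc1 hroot).trans hρ
  have hcL : (n : ℝ) - 2 * s - 3 < c := by linarith
  obtain ⟨hle, heq⟩ := sum_ratio_le hm1 hsum hone hodd2 hcL
  have hle' := mul_le_mul_of_nonneg_left hle (by linarith : (0 : ℝ) ≤ s)
  have hstrict : t < s → (s : ℝ) - c + s * (s / (c - 1) + 3 / (c - 3) +
      ((n : ℝ) - 2 * s - 3) / (c - ((n : ℝ) - 2 * s - 3))) < 0 := fun h =>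
    cut_bound ht' hnt' hc1 hc2 hc3 hroot (by exact_mod_cast h) (by linarith)
  have hnonpos : (s : ℝ) - c + s * (s / (c - 1) + 3 / (c - 3) +
      ((n : ℝ) - 2 * s - 3) / (c - ((n : ℝ) - 2 * s - 3))) ≤ 0 := by
    rcases hts.lt_or_eq with h | h
    · exact (hstrict h).le
    · rw [← h]
      exact hroot.le
  have hmc : ∀ C, (m C : ℝ) < c := by
    intro C
    have : ((m C + (2 * s + 3) : ℕ) : ℝ) ≤ n := by exact_mod_cast hmL C
    push_cast at this
    linarith
  obtain ⟨hzero, hfull⟩ := complete_of_le_spectralRadius hG (m := m) (fun _ => rfl) hadj hmc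
    (Finset.card_pos.1 (by omega)) (by linarith) hcρ
  have hst : s = t := by
    by_contra h
    have := hstrict (lt_of_le_of_ne hts (Ne.symm h))
    linarith
  obtain ⟨-, C₁, C₂, hne, h₁, h₂, hrest⟩ := heq (le_antisymm hle (le_of_mul_le_mul_left
    (by linarith) (by linarith : (0 : ℝ) < s)))
  rw [hst] at h₁
  exact iso_extremalGraph_of_blocks hcard hst (fun _ => rfl) hadj hfull hne h₁ h₂ hrest

end PerfectKMatching

theorem theorem1p4 {V : Type*} [Fintype V] (G : SimpleGraph V) (t k n : ℕ)
    (ht : 1 ≤ t) (hk : Odd k) (hcard : Fintype.card V = n) (hn : Even n)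
    (hnt : 5 * t + 7 ≤ n)
    (hconn : PerfectKMatching.IsTConnected G t)
    (hfrac : PerfectKMatching.HasFractionalPerfectMatching G)
    (hρ : PerfectKMatching.spectralRadius (PerfectKMatching.extremalGraph n t) ≤
      PerfectKMatching.spectralRadius G) :
    PerfectKMatching.HasPerfectKMatching G k ↔
      ¬ Nonempty (G ≃g PerfectKMatching.extremalGraph n t) := by
  constructor
  · rintro h ⟨e⟩
    exact PerfectKMatching.not_hasPerfectKMatching_of_iso hk e h
  · intro h
    obtain ⟨M, hM⟩ := (PerfectKMatching.exists_isPerfectMatching_or_iso ht hcard hn hnt hconn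
      hfrac hρ).resolve_right h
    exact PerfectKMatching.hasPerfectKMatching_of_isPerfectMatching hM k
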